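/- Fix integers $r\ge 1$ and $n\ge 1$, and write $[m]=\{1,\dots,m\}$. For $k\ge 1$ let $\Pi_k^{(r)}$ be the poset, ordered by refinement, of all set partitions of $[rk]$ whose block sizes are divisible by $r$; let $M(k)$ be the number of its minimal elements, and $M(0)=1$. Define the numbers $r_k(\Pi_k^{(r)})$, $k\ge 1$, by the identity of formal power series $$\sum_{k\ge 1} r_k(\Pi_k^{(r)})\,\frac{z^k}{k!\,M(k)}=-\log\Bigl(\sum_{k\ge 0}(-1)^k\frac{z^k}{k!\,M(k)}\Bigr).$$ Let $\mathcal B$ be the set of all $r$-element sets of positive integers (blocks). Two blocks $b,b'\in\mathcal B$ are called crossing unless $\max b<\min b'$ or $\max b'<\min b$ (so every block crosses itself). A heap over $\mathcal B$ is a finite poset $P$ with a labelling $\varepsilon:P\to\mathcal B$ such that (i) $x,y\in P$ are comparable whenever $\varepsilon(x)$ and $\varepsilon(y)$ are crossing, and (ii) $\varepsilon(x)$ and $\varepsilon(y)$ are crossing whenever $y$ covers $x$ in $P$. Heaps are considered up to label-preserving poset isomorphism. A pyramid is a heap with exactly one maximal element. Then $r_n(\Pi_n^{(r)})$ equals the (finite)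 number of pyramids over $\mathcal B$ that have $n$ elements, whose labels are pairwise distinct and are exactly the blocks of some partition of $[rn]$ into blocks of size $r$, and whose unique maximal element is labelled by the block containing $rn$. -/

import Mathlib

noncomputable section

universe u

/-! ### The numbers `r_n(Q_n)` attached to a sequence of posets -/

/-- `M(n)`: the number of minimal elements of `Q n` for `n ≥ 1`, and `M(0) = 1`. -/
def numMinimal (Q : ℕ → Type u) [∀ n, PartialOrder (Q n)] (n : ℕ) : ℕ :=
  if n = 0 then 1 else Nat.card {x : Q n // IsMin x}

/-- The formal power series `∑_{n ≥ 0} (-1)^n z^n / (n! M(n))`. -/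
def signedSeries (Q : ℕ → Type u) [∀ n, PartialOrder (Q n)] : PowerSeries ℚ :=
  PowerSeries.mk fun n => (-1) ^ n / ((n.factorial : ℚ) * numMinimal Q n)

/-- The number `r_n(Q_n)`, read off from
`∑_{n ≥ 1} r_n(Q_n) z^n / (n! M(n)) = - log (∑_{n ≥ 0} (-1)^n z^n / (n! M(n)))`. -/
def rNumber (Q : ℕ → Type u) [∀ n, PartialOrder (Q n)] (n : ℕ) : ℚ :=
  (n.factorial : ℚ) * numMinimal Q n *
    PowerSeries.coeff n (-PowerSeries.logOf (signedSeries Q))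

/-- The numbers `rNumber Q n` satisfy their defining equation as soon as every `Q n` has
a positive finite number of minimal elements. -/
theorem rNumber_spec (Q : ℕ → Type u) [∀ n, PartialOrder (Q n)]
    (hM : ∀ n, numMinimal Q n ≠ 0) :
    (PowerSeries.mk fun n =>
        if n = 0 then 0 else rNumber Q n / ((n.factorial : ℚ) * numMinimal Q n)) =
      -PowerSeries.logOf (signedSeries Q) := by
  ext n
  rw [PowerSeries.coeff_mk]
  split_ifs with h
  · subst h
    have h1 : PowerSeries.constantCoeff (signedSeries Q) = 1 := by
      rw [← PowerSeries.coeff_zero_eq_constantCoeff_apply, signedSeries, PowerSeries.coeff_mk]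
      simp [numMinimal]
    rw [PowerSeries.coeff_zero_eq_constantCoeff_apply, map_neg,
      PowerSeries.constantCoeff_logOf h1, neg_zero]
  · have h2 : (n.factorial : ℚ) * numMinimal Q n ≠ 0 :=
      mul_ne_zero (by exact_mod_cast n.factorial_ne_zero) (by exact_mod_cast hM n)
    rw [rNumber, mul_div_cancel_left₀ _ h2]

/-! ### Set partitions of `[rn]` -/

/-- The set partitions of `[rn] = {1, …, rn}` whose block sizes are divisible by `r`, ordered by
refinement (the order of `Finpartition`: every block of the smaller partition is contained in a
block of the larger one). -/
abbrev DivPartition (r n : ℕ) : Type :=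
  {π : Finpartition (Finset.Icc 1 (r * n)) // ∀ b ∈ π.parts, r ∣ b.card}

/-- The set partitions of `[rn]` all of whose blocks have exactly `r` elements. -/
abbrev UniformPartition (r n : ℕ) : Type :=
  {π : Finpartition (Finset.Icc 1 (r * n)) // ∀ b ∈ π.parts, b.card = r}

/-! ### Heaps and pyramids -/

/-- A heap of pieces from `B` with respect to the relation `R` (meant to be symmetric and
reflexive): a finite poset whose elements are labelled by pieces, such that elements with related
labels are comparable, and labels along a covering relation are related. -/
structure Heap {B : Type u} (R : B → B → Prop) : Type (max u 1) where
  /-- the elements of the heap -/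
  carrier : Type
  [order : PartialOrder carrier]
  [finite : Finite carrier]
  /-- the labelling of the elements by pieces -/
  label : carrier → B
  comparable : ∀ x y : carrier, R (label x) (label y) → x ≤ y ∨ y ≤ x
  covBy_rel : ∀ x y : carrier, x ⋖ y → R (label x) (label y)

namespace Heap

variable {B : Type u} {R : B → B → Prop}

instance (H : Heap R) : PartialOrder H.carrier := H.order

instance (H : Heap R) : Finite H.carrier := H.finite

/-- Isomorphism of heaps: an isomorphism of posets that preserves labels. -/
def Iso (H K : Heap R) : Prop :=
  ∃ e : H.carrier ≃o K.carrier, ∀ x, K.label (e x) = H.label x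

instance isoSetoid (R : B → B → Prop) : Setoid (Heap R) where
  r := Iso
  iseqv :=
    { refl := fun H => ⟨OrderIso.refl _, fun _ => rfl⟩
      symm := by
        rintro H K ⟨e, he⟩
        refine ⟨e.symm, fun x => ?_⟩
        rw [← he, e.apply_symm_apply]
      trans := by
        rintro H K L ⟨e, he⟩ ⟨f, hf⟩
        refine ⟨e.trans f, fun x => ?_⟩
        rw [OrderIso.trans_apply, hf, he] }

/-- A pyramid is a heap with exactly one maximal element. -/
def IsPyramid (H : Heap R) : Prop :=
  ∃! m : H.carrier, IsMax m

end Heap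

/-- The set of heaps with pieces in `B` and relation `R`; as usual, isomorphic
heaps are identified. -/
abbrev HeapClass {B : Type u} (R : B → B → Prop) : Type (max u 1) :=
  Quotient (Heap.isoSetoid R)

/-! ### Blocks and crossings -/

/-- The pieces: `r`-element sets of positive integers. -/
abbrev Block (r : ℕ) : Type :=
  {s : Finset ℕ // s.card = r ∧ ∀ i ∈ s, 1 ≤ i}

/-- Two blocks are crossing unless the largest element of one of them is smaller than the smallest
element of the other one, that is, unless one of them lies entirely to the left of the other. -/
def Crossing {r : ℕ} (s t : Block r) : Prop :=
  ¬ ((∀ i ∈ s.1, ∀ j ∈ t.1, i < j) ∨ (∀ j ∈ t.1, ∀ i ∈ s.1, j < i))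

theorem crossing_refl {r : ℕ} (hr : 1 ≤ r) (s : Block r) : Crossing s s := by
  obtain ⟨i, hi⟩ : s.1.Nonempty := Finset.card_pos.1 (by rw [s.2.1]; exact hr)
  rintro (h | h) <;> exact lt_irrefl i (h i hi i hi)

theorem crossing_symm {r : ℕ} {s t : Block r} (h : Crossing s t) : Crossing t s :=
  fun h' => h h'.symm

/-- The elements of the heap `H` are exactly the blocks of the partition `π`: distinct elements have
distinct labels, and the labels are exactly the blocks of `π`. -/
def HasBlocks {r n : ℕ} (H : Heap (Crossing (r := r))) (π : UniformPartition r n) : Prop :=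
  Function.Injective H.label ∧
    ∀ b : Finset ℕ, b ∈ π.1.parts ↔ ∃ x : H.carrier, (H.label x).1 = b

/-- The set of all (isomorphism classes of) pyramids of `r`-blocks with `n` elements which are
exactly the blocks of a partition of `[rn]` into `r`-blocks, such that the unique maximal element
is the block containing `rn`. -/
def blockPyramids (r n : ℕ) : Set (HeapClass (Crossing (r := r))) :=
  {q | ∃ H : Heap (Crossing (r := r)), Quotient.mk _ H = q ∧ H.IsPyramid ∧
    Nat.card H.carrier = n ∧ (∃ π : UniformPartition r n, HasBlocks H π) ∧
    ∀ m : H.carrier, IsMax m → r * n ∈ (H.label m).1}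

end

/-! Both sides satisfy the same recursion. Put $F=\sum_k(-1)^kz^k/(k!M(k))$. The minimal elements
are the partitions into blocks of size $r$, so $k!M(k)=(rk)!/r!^k$, and comparing coefficients in
$F\cdot(\log F)'=F'$ gives $\sum_{k<m}(-1)^k\binom{rm-1}{rk}r_{m-k}=(-1)^{m-1}$
(`sum_choose_mul_rNumber`).

For the pyramids, fix a finite set $V$ of blocks and $v\in V$. An independent $T\not\ni v$ together
with a pyramid on $V\setminus T$ with maximum $v$ amounts to a heap on $V$, obtained by putting $T$
underneath, with $\max\setminus\{v\}\subseteq T\subseteq\min$ (`card_pyramidOrders_sdiff`). Weighted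
by $(-1)^{|T|}$, each heap contributes an alternating sum over a Boolean interval. It vanishes
unless $\max\setminus\{v\}=\min\setminus\{v\}$, which forces the trivial order, and this is a heap
only if $V$ is independent (`sum_independent_card_pyramidOrders`).

Now sum over all partitions $V$ of a set $A$ of size $rm$, with $v$ the block of a fixed $a\in A$. A
set of $rk$ numbers has exactly one independent partition, its cut into consecutive runs
(`existsUnique_independent_isUniformPartition`). So one $V$ survives on one side, and on the other
side $T$ is determined by its union $S\subseteq A\setminus\{a\}$ (`sum_pyramidCount_sdiff`). There
are $\binom{rm-1}{rk}$ sets $S$ of size $rk$, so by induction the pyramid count depends only on $m$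
and equals $r_m$ (`pyramidCount_eq`). -/

open Finset

/-! ### Heap orders on a finite set of labels -/

open scoped Classical in
/-- The elements of `V` below which `ρ` has no other element. -/
noncomputable def minElements {α : Type*} (V : Finset α) (ρ : Finset (α × α)) : Finset α :=
  {x ∈ V | ∀ y, (y, x) ∈ ρ → y = x}

open scoped Classical in
/-- The elements of `V` above which `ρ` has no other element. -/
noncomputable def maxElements {α : Type*} (V : Finset α) (ρ : Finset (α × α)) : Finset α :=
  {x ∈ V | ∀ y, (x, y) ∈ ρ → y = x}

theorem mem_minElements {α : Type*} {V : Finset α} {ρ : Finset (α × α)} {x : α} :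
    x ∈ minElements V ρ ↔ x ∈ V ∧ ∀ y, (y, x) ∈ ρ → y = x := by
  simp [minElements]

theorem mem_maxElements {α : Type*} {V : Finset α} {ρ : Finset (α × α)} {x : α} :
    x ∈ maxElements V ρ ↔ x ∈ V ∧ ∀ y, (x, y) ∈ ρ → y = x := by
  simp [maxElements]

theorem minElements_subset {α : Type*} (V : Finset α) (ρ : Finset (α × α)) :
    minElements V ρ ⊆ V :=
  fun _ hx => (mem_minElements.1 hx).1

/-- The set of pairs `ρ` is a partial order on `V` that makes `V`, labelled by its own elements,
a heap with respect to `C`. The covering condition is replaced by the equivalent condition that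
from each element one can go up towards any larger element by a step along `C`. -/
structure IsHeapOrder {α : Type*} (C : α → α → Prop) (V : Finset α) (ρ : Finset (α × α)) :
    Prop where
  mem : ∀ x y, (x, y) ∈ ρ → x ∈ V ∧ y ∈ V
  refl : ∀ x ∈ V, (x, x) ∈ ρ
  trans : ∀ x y z, (x, y) ∈ ρ → (y, z) ∈ ρ → (x, z) ∈ ρ
  antisymm : ∀ x y, (x, y) ∈ ρ → (y, x) ∈ ρ → x = y
  comparable : ∀ x ∈ V, ∀ y ∈ V, C x y → (x, y) ∈ ρ ∨ (y, x) ∈ ρ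
  step : ∀ x y, (x, y) ∈ ρ → x ≠ y → ∃ z, C x z ∧ x ≠ z ∧ (x, z) ∈ ρ ∧ (z, y) ∈ ρ

open scoped Classical in
/-- All heap orders on `V`. -/
noncomputable def heapOrders {α : Type*} (C : α → α → Prop) (V : Finset α) :
    Finset (Finset (α × α)) :=
  {ρ ∈ (V ×ˢ V).powerset | IsHeapOrder C V ρ}

theorem mem_heapOrders {α : Type*} {C : α → α → Prop} {V : Finset α} {ρ : Finset (α × α)} :
    ρ ∈ heapOrders C V ↔ IsHeapOrder C V ρ := by
  simp only [heapOrders, mem_filter, mem_powerset, and_iff_right_iff_imp]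
  rintro h ⟨x, y⟩ hxy
  exact mem_product.2 (h.mem x y hxy)

/-- No two distinct elements of `T` are related by `C`. -/
def Independent {α : Type*} (C : α → α → Prop) (T : Finset α) : Prop :=
  ∀ x ∈ T, ∀ y ∈ T, C x y → x = y

theorem exists_le_forall_le_eq {α : Type*} (V : Finset α) (le : α → α → Prop)
    (hmem : ∀ x y, le x y → y ∈ V) (hrefl : ∀ x ∈ V, le x x)
    (htrans : ∀ x y z, le x y → le y z → le x z) (hanti : ∀ x y, le x y → le y x → x = y)
    {x : α} (hx : x ∈ V) : ∃ m ∈ V, le x m ∧ ∀ y, le m y → y = m := by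
  classical
  -- Among the elements above `x`, take one with the largest down-set; anything strictly above it
  -- would have a strictly larger down-set.
  obtain ⟨m, hm, hmax⟩ := ({y ∈ V | le x y}).exists_max_image (fun y => #{z ∈ V | le z y})
    ⟨x, by simp [hx, hrefl x hx]⟩
  rw [mem_filter] at hm
  refine ⟨m, hm.1, hm.2, fun y hy => ?_⟩
  by_contra hne
  have hyV := hmem _ _ hy
  refine absurd (hmax y (by simp [hyV, htrans _ _ _ hm.2 hy])) (not_le.2 (card_lt_card ?_))
  refine (ssubset_iff_of_subset ?_).2 ⟨y, by simp [hyV, hrefl y hyV], ?_⟩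
  · intro z hz
    rw [mem_filter] at hz ⊢
    exact ⟨hz.1, htrans _ _ _ hz.2 hy⟩
  · intro h
    exact hne (hanti _ _ (mem_filter.1 h).2 hy)

namespace IsHeapOrder

variable {α : Type*} {C : α → α → Prop} {V : Finset α} {ρ : Finset (α × α)}

theorem exists_le_maxElements (h : IsHeapOrder C V ρ) {x : α} (hx : x ∈ V) :
    ∃ m ∈ maxElements V ρ, (x, m) ∈ ρ := by
  obtain ⟨m, hm, hxm, hmax⟩ := exists_le_forall_le_eq V (fun x y => (x, y) ∈ ρ)
    (fun x y hxy => (h.mem x y hxy).2) h.refl h.trans h.antisymm hx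
  exact ⟨m, mem_maxElements.2 ⟨hm, hmax⟩, hxm⟩

theorem exists_minElements_le (h : IsHeapOrder C V ρ) {x : α} (hx : x ∈ V) :
    ∃ m ∈ minElements V ρ, (m, x) ∈ ρ := by
  obtain ⟨m, hm, hxm, hmin⟩ := exists_le_forall_le_eq V (fun x y => (y, x) ∈ ρ)
    (fun x y hxy => (h.mem y x hxy).1) h.refl (fun x y z h1 h2 => h.trans z y x h2 h1)
    (fun x y h1 h2 => h.antisymm x y h2 h1) hx
  exact ⟨m, mem_minElements.2 ⟨hm, hmin⟩, hxm⟩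

theorem independent_of_subset_minElements (h : IsHeapOrder C V ρ) {T : Finset α}
    (hT : T ⊆ minElements V ρ) : Independent C T := by
  intro x hx y hy hxy
  have h1 := mem_minElements.1 (hT hx)
  have h2 := mem_minElements.1 (hT hy)
  rcases h.comparable x h1.1 y h2.1 hxy with h3 | h3
  · exact h2.2 x h3
  · exact (h1.2 y h3).symm

/-- Removing minimal elements from a heap leaves a heap. -/
theorem sdiff [DecidableEq α] (h : IsHeapOrder C V ρ) {T : Finset α}
    (hT : T ⊆ minElements V ρ) :
    IsHeapOrder C (V \ T) {p ∈ ρ | p.1 ∉ T} := by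
  have key : ∀ x y, (x, y) ∈ ρ → x ∉ T → y ∉ T := by
    intro x y hxy hx hy
    exact hx ((mem_minElements.1 (hT hy)).2 x hxy ▸ hy)
  refine ⟨?_, ?_, ?_, ?_, ?_, ?_⟩
  · intro x y hxy
    simp only [mem_filter] at hxy
    have := h.mem x y hxy.1
    have := key x y hxy.1 hxy.2
    simp_all
  · intro x hx
    rw [mem_sdiff] at hx
    simp [hx.2, h.refl x hx.1]
  · intro x y z
    simp only [mem_filter]
    exact fun h1 h2 => ⟨h.trans x y z h1.1 h2.1, h1.2⟩
  · intro x y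
    simp only [mem_filter]
    exact fun h1 h2 => h.antisymm x y h1.1 h2.1
  · intro x hx y hy hxy
    rw [mem_sdiff] at hx hy
    simp only [mem_filter, hx.2, hy.2, not_false_eq_true, and_true]
    exact h.comparable x hx.1 y hy.1 hxy
  · intro x y hxy hne
    simp only [mem_filter] at hxy
    obtain ⟨z, h1, h2, h3, h4⟩ := h.step x y hxy.1 hne
    exact ⟨z, h1, h2, by simp [h3, hxy.2], by simp [h4, key x z h3 hxy.2]⟩

end IsHeapOrder

/-! ### Putting an independent set underneath, and the sign-reversing inversion -/

open scoped Classical in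
/-- The order obtained from `σ` by putting the independent elements of `T` underneath. -/
noncomputable def addBelow {α : Type*} (C : α → α → Prop) (V T : Finset α)
    (σ : Finset (α × α)) : Finset (α × α) :=
  {p ∈ V ×ˢ V | p ∈ σ ∨ p.1 ∈ T ∧ (p.1 = p.2 ∨ ∃ z, C p.1 z ∧ (z, p.2) ∈ σ)}

theorem mem_addBelow_iff {α : Type*} {C : α → α → Prop} {V T : Finset α} {σ : Finset (α × α)}
    {x y : α} : (x, y) ∈ addBelow C V T σ ↔ (x ∈ V ∧ y ∈ V) ∧
      ((x, y) ∈ σ ∨ x ∈ T ∧ (x = y ∨ ∃ z, C x z ∧ (z, y) ∈ σ)) := by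
  simp only [addBelow, mem_filter, mem_product]

theorem mem_addBelow {α : Type*} [DecidableEq α] {C : α → α → Prop} {V T : Finset α}
    {σ : Finset (α × α)}
    (hσ : IsHeapOrder C (V \ T) σ) (hT : T ⊆ V) {x y : α} :
    (x, y) ∈ addBelow C V T σ ↔
      (x, y) ∈ σ ∨ x ∈ T ∧ (x = y ∨ ∃ z, C x z ∧ (z, y) ∈ σ) := by
  rw [mem_addBelow_iff, and_iff_right_iff_imp]
  rintro (h | ⟨h, rfl | ⟨z, -, h3⟩⟩)
  · have := hσ.mem _ _ h
    simp_all
  · exact ⟨hT h, hT h⟩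
  · have := hσ.mem _ _ h3
    exact ⟨hT h, by simp_all⟩

/-- A pair starting in `T` either stays at its starting point or leads into `V \ T`, and no pair
leads from `V \ T` into `T`; hence transitivity and antisymmetry reduce to those of `σ`.
Independence leaves no comparability to check between distinct elements of `T`, and symmetry of `C`
lets the element of `T` always be the lower one. -/
theorem isHeapOrder_addBelow {α : Type*} [DecidableEq α] {C : α → α → Prop}
    (hC : ∀ x y, C x y → C y x) {V T : Finset α} {σ : Finset (α × α)}
    (hσ : IsHeapOrder C (V \ T) σ) (hT : T ⊆ V) (hind : Independent C T) :
    IsHeapOrder C V (addBelow C V T σ) := by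
  have hmem := @hσ.mem
  simp only [mem_sdiff] at hmem
  refine ⟨?_, ?_, ?_, ?_, ?_, ?_⟩
  · intro x y hxy
    exact (mem_addBelow_iff.1 hxy).1
  · intro x hx
    rw [mem_addBelow hσ hT]
    by_cases h : x ∈ T
    · exact Or.inr ⟨h, Or.inl rfl⟩
    · exact Or.inl (hσ.refl x (by simp [hx, h]))
  · intro x y z
    simp only [mem_addBelow hσ hT]
    have := hσ.trans
    grind
  · intro x y
    simp only [mem_addBelow hσ hT]
    have := hσ.antisymm
    grind
  · intro x hx y hy hxy
    simp only [mem_addBelow hσ hT]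
    have h1 := hσ.refl
    have h2 := hσ.comparable x
    have h3 := hC x y hxy
    have h4 := hind x
    simp only [mem_sdiff] at h1 h2
    grind
  · intro x y
    simp only [mem_addBelow hσ hT]
    have h1 := hσ.step x y
    have h2 := hσ.refl
    simp only [mem_sdiff] at h2
    rintro (h | ⟨h, rfl | ⟨z, h3, h4⟩⟩) hne
    · obtain ⟨z, hz⟩ := h1 h hne
      exact ⟨z, by grind⟩
    · exact absurd rfl hne
    · exact ⟨z, h3, by grind⟩

/-- The heap orders on `V` for which `v` is the only maximal element. -/
noncomputable def pyramidOrders {α : Type*} (C : α → α → Prop) (V : Finset α) (v : α) :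
    Finset (Finset (α × α)) :=
  open scoped Classical in {ρ ∈ heapOrders C V | maxElements V ρ = {v}}

/-- Pyramids on the complement of an independent set `T` correspond to heaps in which the elements
of `T` are minimal and all maximal elements but `v` belong to `T`. -/
theorem card_pyramidOrders_sdiff {α : Type*} [DecidableEq α] {C : α → α → Prop}
    (hC : ∀ x y, C x y → C y x) {V T : Finset α} {v : α} (hv : v ∈ V) (hT : T ⊆ V)
    (hvT : v ∉ T) (hind : Independent C T) :
    #(pyramidOrders C (V \ T) v) =
      #{ρ ∈ heapOrders C V | (maxElements V ρ).erase v ⊆ T ∧ T ⊆ minElements V ρ} := by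
  refine card_nbij' (addBelow C V T) (fun ρ => {p ∈ ρ | p.1 ∉ T}) ?_ ?_ ?_ ?_
  · intro σ hσ
    simp only [pyramidOrders, coe_filter, Set.mem_ofPred_eq, mem_heapOrders] at hσ ⊢
    obtain ⟨hσ, hmax⟩ := hσ
    have hmem := @hσ.mem
    simp only [mem_sdiff] at hmem
    refine ⟨isHeapOrder_addBelow hC hσ hT hind, fun x hx => ?_, fun x hx => ?_⟩
    · rw [mem_erase, mem_maxElements] at hx
      by_contra hxT
      refine hx.1 (mem_singleton.1 (hmax ▸ mem_maxElements.2 ⟨by simp [hx.2.1, hxT], ?_⟩))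
      intro y hy
      exact hx.2.2 y ((mem_addBelow hσ hT).2 (Or.inl hy))
    · refine mem_minElements.2 ⟨hT hx, fun y hy => ?_⟩
      rw [mem_addBelow hσ hT] at hy
      grind
  · intro ρ hρ
    simp only [pyramidOrders, coe_filter, Set.mem_ofPred_eq, mem_heapOrders] at hρ ⊢
    obtain ⟨hρ, hmax, hmin⟩ := hρ
    have key : maxElements (V \ T) {p ∈ ρ | p.1 ∉ T} ⊆ {v} := by
      intro x hx
      simp only [mem_maxElements, mem_sdiff, mem_filter] at hx
      by_contra hne
      refine hx.1.2 (hmax (mem_erase.2 ⟨by simpa using hne, mem_maxElements.2 ⟨hx.1.1, ?_⟩⟩))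
      exact fun y hy => hx.2 y ⟨hy, hx.1.2⟩
    -- Since `v` survives the removal of `T`, the remaining heap is nonempty and has a maximal
    -- element, which can only be `v`.
    refine ⟨hρ.sdiff hmin, key.antisymm ?_⟩
    obtain ⟨m, hm, -⟩ := (hρ.sdiff hmin).exists_le_maxElements (mem_sdiff.2 ⟨hv, hvT⟩)
    exact singleton_subset_iff.2 (mem_singleton.1 (key hm) ▸ hm)
  · intro σ hσ
    simp only [pyramidOrders, coe_filter, Set.mem_ofPred_eq, mem_heapOrders] at hσ
    have hmem := @hσ.1.mem
    simp only [mem_sdiff] at hmem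
    ext ⟨x, y⟩
    simp only [mem_filter, mem_addBelow hσ.1 hT]
    grind
  · intro ρ hρ
    simp only [coe_filter, Set.mem_ofPred_eq, mem_heapOrders] at hρ
    obtain ⟨hρ, -, hmin⟩ := hρ
    have hmem := hρ.mem
    have hrefl := hρ.refl
    have htrans := hρ.trans
    have key : ∀ x y, (x, y) ∈ ρ → y ∈ T → x = y := by
      intro x y hxy hy
      exact (mem_minElements.1 (hmin hy)).2 x hxy
    ext ⟨x, y⟩
    rw [mem_addBelow (hρ.sdiff hmin) hT]
    simp only [mem_filter]
    constructor
    · rintro (h | ⟨h, rfl | ⟨z, h1, h2, h3⟩⟩)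
      · exact h.1
      · exact hrefl _ (hT h)
      · rcases hρ.comparable x (hT h) z (hmem _ _ h2).1 h1 with h4 | h4
        · exact htrans _ _ _ h4 h2
        · exact absurd h (key z x h4 h ▸ h3)
    · intro h
      by_cases hx : x ∈ T
      · refine Or.inr ⟨hx, ?_⟩
        by_cases hxy : x = y
        · exact Or.inl hxy
        · obtain ⟨z, h1, h2, h3, h4⟩ := hρ.step x y h hxy
          exact Or.inr ⟨z, h1, h4, fun hz => h2 (key x z h3 hz)⟩
      · exact Or.inl ⟨h, hx⟩

theorem sum_Icc_neg_one_pow_card {α : Type*} [DecidableEq α] (s t : Finset α) :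
    (∑ u ∈ Icc s t, (-1 : ℚ) ^ #u) = if s = t then (-1) ^ #s else 0 := by
  by_cases h : s ⊆ t
  · rw [Icc_eq_image_powerset h, sum_image]
    · have h1 : ∀ u ∈ (t \ s).powerset, (-1 : ℚ) ^ #(s ∪ u) = (-1) ^ #s * (((-1) ^ #u : ℤ) : ℚ) := by
        intro u hu
        rw [card_union_of_disjoint, pow_add]
        · push_cast; rfl
        · exact (disjoint_sdiff.mono_right (mem_powerset.1 hu))
      rw [sum_congr rfl h1, ← mul_sum, ← Int.cast_sum, sum_powerset_neg_one_pow_card]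
      have : t \ s = ∅ ↔ s = t := by
        rw [sdiff_eq_empty_iff_subset]
        exact ⟨fun h' => h.antisymm h', fun h' => h'.ge⟩
      simp [this]
    · intro u hu w hw huw
      simp only [coe_powerset, Set.mem_preimage, Set.mem_powerset_iff, coe_subset] at hu hw
      ext x
      have h1 := @hu x
      have h2 := @hw x
      have h3 : x ∈ s ∪ u ↔ x ∈ s ∪ w := by simp only [huw]
      grind
  · rw [Icc_eq_empty (by simpa using h), sum_empty, if_neg]
    rintro rfl
    exact h Subset.rfl

/-- Only the trivial heap has the same minimal and maximal elements, up to `v`. -/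
theorem IsHeapOrder.erase_maxElements_eq_iff {α : Type*} [DecidableEq α] {C : α → α → Prop}
    {V : Finset α} {ρ : Finset (α × α)} (h : IsHeapOrder C V ρ) (v : α) :
    (maxElements V ρ).erase v = (minElements V ρ).erase v ↔ ρ = V.diag := by
  constructor
  · intro heq
    have h1 : ∀ x, x ≠ v → (x ∈ maxElements V ρ ↔ x ∈ minElements V ρ) := by
      intro x hx
      simpa [hx] using congrArg (x ∈ ·) heq
    have key : ∀ x y, (x, y) ∈ ρ → x = y := by
      intro x y hxy
      -- Enclose `x ≤ y` between a minimal `l` and a maximal `m`. Whichever of the two differs from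
      -- `v` is both minimal and maximal, so `l = m` and everything in between collapses.
      obtain ⟨m, hm, hyx⟩ := h.exists_le_maxElements (h.mem x y hxy).2
      obtain ⟨l, hl, hlx⟩ := h.exists_minElements_le (h.mem x y hxy).1
      have hlm := h.trans _ _ _ hlx (h.trans _ _ _ hxy hyx)
      have hm' := mem_maxElements.1 hm
      have hl' := mem_minElements.1 hl
      have : l = m := by
        by_cases hlv : l = v
        · by_cases hmv : m = v
          · rw [hlv, hmv]
          · exact (mem_minElements.1 ((h1 m hmv).1 hm)).2 l hlm
        · exact ((mem_maxElements.1 ((h1 l hlv).2 hl)).2 m hlm).symm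
      subst this
      have h2 := hl'.2 x (h.trans _ _ _ hxy hyx)
      have h3 := hm'.2 y (h.trans _ _ _ hlx hxy)
      rw [h2, h3]
    ext ⟨x, y⟩
    simp only [mem_diag]
    constructor
    · exact fun hxy => ⟨(h.mem x y hxy).1, key x y hxy⟩
    · rintro ⟨hx, rfl⟩
      exact h.refl x hx
  · rintro rfl
    ext x
    simp only [mem_erase, mem_maxElements, mem_minElements, mem_diag]
    grind

/-- For the trivial order, comparability of related labels is the only heap axiom with content. -/
theorem isHeapOrder_diag_iff {α : Type*} [DecidableEq α] {C : α → α → Prop} {V : Finset α} :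
    IsHeapOrder C V V.diag ↔ Independent C V := by
  constructor
  · intro h x hx y hy hxy
    have := h.comparable x hx y hy hxy
    simp only [mem_diag] at this
    grind
  · intro h
    refine ⟨?_, ?_, ?_, ?_, ?_, ?_⟩ <;> simp only [mem_diag]
    · grind
    · grind
    · grind
    · grind
    · intro x hx y hy hxy
      have := h x hx y hy hxy
      grind
    · grind

/-- Inversion: the signed count of pairs of an independent set not containing `v` and a pyramid
with maximum `v` on the complement vanishes unless everything is independent. -/
theorem sum_independent_card_pyramidOrders {α : Type*} [DecidableEq α] {C : α → α → Prop}
    [DecidablePred (Independent C)] (hC : ∀ x y, C x y → C y x) {V : Finset α} {v : α} (hv : v ∈ V) :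
    (∑ T ∈ V.powerset with v ∉ T ∧ Independent C T,
      (-1 : ℚ) ^ #T * #(pyramidOrders C (V \ T) v)) =
      if Independent C V then (-1) ^ (#V - 1) else 0 := by
  have h1 : ∀ T ∈ V.powerset.filter (fun T => v ∉ T ∧ Independent C T),
      (-1 : ℚ) ^ #T * #(pyramidOrders C (V \ T) v) =
      ∑ ρ ∈ heapOrders C V,
        if (maxElements V ρ).erase v ⊆ T ∧ T ⊆ minElements V ρ then (-1 : ℚ) ^ #T else 0 := by
    intro T hT
    rw [mem_filter, mem_powerset] at hT
    rw [card_pyramidOrders_sdiff hC hv hT.1 hT.2.1 hT.2.2, ← sum_filter, sum_const,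
      nsmul_eq_mul, mul_comm]
  have h2 : ∀ ρ ∈ heapOrders C V, (∑ T ∈ V.powerset.filter (fun T => v ∉ T ∧ Independent C T),
      if (maxElements V ρ).erase v ⊆ T ∧ T ⊆ minElements V ρ then (-1 : ℚ) ^ #T else 0) =
      if ρ = V.diag then (-1) ^ (#V - 1) else 0 := by
    intro ρ hρ
    rw [mem_heapOrders] at hρ
    rw [← sum_filter]
    -- Independence of `T` is automatic here, as distinct minimal elements are never related; so `T`
    -- runs over a full Boolean interval.
    trans ∑ T ∈ Icc ((maxElements V ρ).erase v) ((minElements V ρ).erase v), (-1 : ℚ) ^ #T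
    · refine sum_congr ?_ fun _ _ => rfl
      ext T
      simp only [mem_filter, mem_powerset, mem_Icc, subset_erase]
      constructor
      · rintro ⟨⟨-, h3, -⟩, h4, h5⟩
        exact ⟨h4, h5, h3⟩
      · rintro ⟨h4, h5, h3⟩
        exact ⟨⟨h5.trans (minElements_subset V ρ), h3, hρ.independent_of_subset_minElements h5⟩, h4, h5⟩
    · rw [sum_Icc_neg_one_pow_card]
      simp only [hρ.erase_maxElements_eq_iff v]
      refine if_ctx_congr Iff.rfl ?_ fun _ => rfl
      rintro rfl
      have : maxElements V V.diag = V := by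
        ext x
        simp only [mem_maxElements, mem_diag]
        grind
      rw [this, card_erase_of_mem hv]
  rw [sum_congr rfl h1, sum_comm, sum_congr rfl h2, sum_ite_eq']
  simp only [mem_heapOrders, isHeapOrder_diag_iff]

/-! ### Partitions into blocks of size `r` -/

/-- The finset `V` is a set partition of `A` into blocks of size `r`. -/
structure IsUniformPartition (r : ℕ) (A : Finset ℕ) (V : Finset (Finset ℕ)) : Prop where
  subset : ∀ b ∈ V, b ⊆ A
  card_block : ∀ b ∈ V, #b = r
  exists_mem : ∀ x ∈ A, ∃ b ∈ V, x ∈ b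
  eq_of_mem : ∀ b ∈ V, ∀ c ∈ V, ∀ x ∈ b, x ∈ c → b = c

open scoped Classical in
/-- All set partitions of `A` into blocks of size `r`. -/
noncomputable def uniformPartitions (r : ℕ) (A : Finset ℕ) : Finset (Finset (Finset ℕ)) :=
  {V ∈ A.powerset.powerset | IsUniformPartition r A V}

theorem mem_uniformPartitions {r : ℕ} {A : Finset ℕ} {V : Finset (Finset ℕ)} :
    V ∈ uniformPartitions r A ↔ IsUniformPartition r A V := by
  simp only [uniformPartitions, mem_filter, mem_powerset, and_iff_right_iff_imp]
  exact fun h b hb => mem_powerset.2 (h.subset b hb)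

namespace IsUniformPartition

variable {r : ℕ} {A : Finset ℕ} {V : Finset (Finset ℕ)}

theorem nonempty_block (hr : 1 ≤ r) (h : IsUniformPartition r A V) {b : Finset ℕ} (hb : b ∈ V) :
    b.Nonempty :=
  card_pos.1 (by rw [h.card_block b hb]; exact hr)

theorem biUnion_eq (h : IsUniformPartition r A V) : V.biUnion id = A := by
  ext x
  simp only [mem_biUnion, id]
  exact ⟨fun ⟨b, hb, hx⟩ => h.subset b hb hx, h.exists_mem x⟩

theorem mul_card (h : IsUniformPartition r A V) : r * #V = #A := by
  rw [← h.biUnion_eq, card_biUnion,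
    (sum_congr rfl h.card_block : ∑ b ∈ V, #(id b) = ∑ b ∈ V, r), sum_const,
    smul_eq_mul, mul_comm]
  intro b hb c hc hne
  exact disjoint_left.2 fun x hx hx' => hne (h.eq_of_mem b hb c hc x hx hx')

theorem of_subset (h : IsUniformPartition r A V) {T : Finset (Finset ℕ)} (hT : T ⊆ V) :
    IsUniformPartition r (T.biUnion id) T where
  subset b hb := subset_biUnion_of_mem id hb
  card_block b hb := h.card_block b (hT hb)
  exists_mem x hx := by simpa using hx
  eq_of_mem b hb c hc := h.eq_of_mem b (hT hb) c (hT hc)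

theorem sdiff (h : IsUniformPartition r A V) {T : Finset (Finset ℕ)} (hT : T ⊆ V) :
    IsUniformPartition r (A \ T.biUnion id) (V \ T) := by
  convert h.of_subset (sdiff_subset : V \ T ⊆ V) using 1
  ext x
  simp only [mem_sdiff, mem_biUnion, id]
  have h1 := h.exists_mem x
  have h2 := h.subset
  have h3 := h.eq_of_mem
  constructor
  · rintro ⟨hx, hx'⟩
    obtain ⟨b, hb, hxb⟩ := h1 hx
    exact ⟨b, ⟨hb, fun hbT => hx' ⟨b, hbT, hxb⟩⟩, hxb⟩
  · rintro ⟨b, ⟨hb, hbT⟩, hxb⟩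
    refine ⟨h2 b hb hxb, ?_⟩
    rintro ⟨c, hc, hxc⟩
    exact hbT (h3 b hb c (hT hc) x hxb hxc ▸ hc)

theorem erase (h : IsUniformPartition r A V) {b : Finset ℕ} (hb : b ∈ V) :
    IsUniformPartition r (A \ b) (V.erase b) := by
  have := h.sdiff (singleton_subset_iff.2 hb)
  rwa [singleton_biUnion, id, sdiff_singleton_eq_erase] at this

theorem union {S : Finset ℕ} {T W : Finset (Finset ℕ)} (hS : S ⊆ A)
    (hT : IsUniformPartition r S T) (hW : IsUniformPartition r (A \ S) W) :
    IsUniformPartition r A (T ∪ W) where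
  subset b hb := by
    rcases mem_union.1 hb with h | h
    · exact (hT.subset b h).trans hS
    · exact (hW.subset b h).trans sdiff_subset
  card_block b hb := (mem_union.1 hb).elim (hT.card_block b) (hW.card_block b)
  exists_mem x hx := by
    by_cases hxS : x ∈ S
    · obtain ⟨b, hb⟩ := hT.exists_mem x hxS
      exact ⟨b, mem_union_left _ hb.1, hb.2⟩
    · obtain ⟨b, hb⟩ := hW.exists_mem x (mem_sdiff.2 ⟨hx, hxS⟩)
      exact ⟨b, mem_union_right _ hb.1, hb.2⟩
  eq_of_mem b hb c hc x hxb hxc := by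
    rcases mem_union.1 hb with hb | hb <;> rcases mem_union.1 hc with hc | hc
    · exact hT.eq_of_mem b hb c hc x hxb hxc
    · exact absurd (hT.subset b hb hxb) (mem_sdiff.1 (hW.subset c hc hxc)).2
    · exact absurd (hT.subset c hc hxc) (mem_sdiff.1 (hW.subset b hb hxb)).2
    · exact hW.eq_of_mem b hb c hc x hxb hxc

theorem disjoint {S : Finset ℕ} {T W : Finset (Finset ℕ)} (hr : 1 ≤ r)
    (hT : IsUniformPartition r S T) (hW : IsUniformPartition r (A \ S) W) : Disjoint T W := by
  refine disjoint_left.2 fun b hb hb' => ?_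
  obtain ⟨x, hx⟩ := hT.nonempty_block hr hb
  exact (mem_sdiff.1 (hW.subset b hb' hx)).2 (hT.subset b hb hx)

theorem singleton {b : Finset ℕ} (hb : #b = r) : IsUniformPartition r b {b} := by
  refine ⟨?_, ?_, ?_, ?_⟩ <;> simp [hb]

theorem insert {b : Finset ℕ} (hbA : b ⊆ A) (hb : #b = r)
    (hW : IsUniformPartition r (A \ b) V) : IsUniformPartition r A (insert b V) :=
  insert_eq b V ▸ union hbA (singleton hb) hW

theorem notMem {b : Finset ℕ} (hr : 1 ≤ r) (hb : #b = r)
    (hW : IsUniformPartition r (A \ b) V) : b ∉ V :=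
  disjoint_singleton_left.1 (disjoint hr (singleton hb) hW)

end IsUniformPartition

/-- Choosing a partition of `A` and a subset of its blocks amounts to choosing a subset of `A`, and
partitions of this subset and of its complement. -/
theorem sum_uniformPartitions_sum_powerset {M : Type*} [AddCommMonoid M] {r : ℕ} (hr : 1 ≤ r)
    (A : Finset ℕ) (f : Finset (Finset ℕ) → Finset (Finset ℕ) → M) :
    ∑ V ∈ uniformPartitions r A, ∑ T ∈ V.powerset, f T (V \ T) =
      ∑ S ∈ A.powerset, ∑ T ∈ uniformPartitions r S, ∑ W ∈ uniformPartitions r (A \ S), f T W := by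
  simp only [← sum_product']
  rw [sum_sigma', sum_sigma']
  refine sum_nbij' (fun p => ⟨p.2.biUnion id, (p.2, p.1 \ p.2)⟩) (fun p => ⟨p.2.1 ∪ p.2.2, p.2.1⟩)
    ?_ ?_ ?_ ?_ ?_
  · rintro ⟨V, T⟩ h
    simp only [mem_sigma, mem_uniformPartitions, mem_powerset, mem_product] at h ⊢
    refine ⟨?_, h.1.of_subset h.2, h.1.sdiff h.2⟩
    exact h.1.biUnion_eq ▸ biUnion_subset_biUnion_of_subset_left id h.2
  · rintro ⟨S, T, W⟩ h
    simp only [mem_sigma, mem_uniformPartitions, mem_powerset, mem_product] at h ⊢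
    exact ⟨.union h.1 h.2.1 h.2.2, subset_union_left⟩
  · rintro ⟨V, T⟩ h
    simp only [mem_sigma, mem_powerset] at h
    simp [union_sdiff_of_subset h.2]
  · rintro ⟨S, T, W⟩ h
    simp only [mem_sigma, mem_uniformPartitions, mem_powerset, mem_product] at h
    simp only [h.2.1.biUnion_eq]
    rw [union_sdiff_cancel_left (h.2.1.disjoint hr h.2.2)]
  · rintro ⟨V, T⟩ h
    rfl

/-- Fix `a ∈ A`. Its block is determined by `r - 1` further elements, and the rest is a partition of
the complement; this is the recursion of `Nat.uniformBell`. -/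
theorem card_uniformPartitions {r m : ℕ} (hr : 1 ≤ r) {A : Finset ℕ} (hA : #A = r * m) :
    #(uniformPartitions r A) = m.uniformBell r := by
  induction m generalizing A with
  | zero =>
    rw [mul_zero, card_eq_zero] at hA
    subst hA
    rw [Nat.uniformBell_zero_left, card_eq_one]
    refine ⟨∅, ?_⟩
    ext V
    rw [mem_uniformPartitions, mem_singleton]
    constructor
    · intro h
      refine eq_empty_of_forall_notMem fun b hb => ?_
      obtain ⟨x, hx⟩ := h.nonempty_block hr hb
      exact absurd (h.subset b hb hx) (notMem_empty x)
    · rintro rfl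
      constructor <;> simp
  | succ m ih =>
    obtain ⟨a, ha⟩ : A.Nonempty := card_pos.1 (by rw [hA]; positivity)
    trans #((powersetCard (r - 1) (A.erase a)).sigma
      fun c => uniformPartitions r (A \ Insert.insert a c))
    · symm
      have key : ∀ c ∈ powersetCard (r - 1) (A.erase a),
          Insert.insert a c ⊆ A ∧ #(Insert.insert a c) = r ∧ a ∉ c := by
        intro c hc
        rw [mem_powersetCard] at hc
        have hac : a ∉ c := fun h => by simpa using hc.1 h
        refine ⟨insert_subset ha (hc.1.trans (erase_subset _ _)), ?_, hac⟩
        rw [card_insert_of_notMem hac, hc.2]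
        omega
      refine card_nbij (fun p => Insert.insert (Insert.insert a p.1) p.2) ?_ ?_ ?_
      · rintro ⟨c, W⟩ h
        simp only [coe_sigma, Set.mem_sigma_iff, mem_coe, mem_uniformPartitions] at h ⊢
        exact .insert (key c h.1).1 (key c h.1).2.1 h.2
      · rintro ⟨c, W⟩ h ⟨c', W'⟩ h' heq
        simp only [coe_sigma, Set.mem_sigma_iff, mem_coe, mem_uniformPartitions] at h h' heq
        have k := key c h.1
        have k' := key c' h'.1
        have hi := IsUniformPartition.insert k.1 k.2.1 h.2
        have h1 : Insert.insert a c = Insert.insert a c' :=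
          hi.eq_of_mem _ (mem_insert_self _ _) _ (heq ▸ mem_insert_self _ _) a
            (mem_insert_self _ _) (mem_insert_self _ _)
        have h2 : c = c' := by
          rw [← erase_insert k.2.2, h1, erase_insert k'.2.2]
        subst h2
        have h3 : W = W' := by
          rw [← erase_insert (h.2.notMem hr k.2.1), heq, erase_insert (h'.2.notMem hr k.2.1)]
        rw [h3]
      · intro V hV
        rw [mem_coe, mem_uniformPartitions] at hV
        obtain ⟨b, hb, hab⟩ := hV.exists_mem a ha
        refine ⟨⟨b.erase a, V.erase b⟩, ?_, ?_⟩
        · simp only [coe_sigma, Set.mem_sigma_iff, mem_coe, mem_uniformPartitions,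
            mem_powersetCard, insert_erase hab]
          exact ⟨⟨erase_subset_erase a (hV.subset b hb),
            by rw [card_erase_of_mem hab, hV.card_block b hb]⟩, hV.erase hb⟩
        · simp only [insert_erase hab, insert_erase hb]
    · rw [card_sigma, Nat.uniformBell_succ_left]
      rw [sum_congr rfl (g := fun _ => m.uniformBell r), sum_const, card_powersetCard,
        card_erase_of_mem ha, hA, smul_eq_mul]
      · rw [mul_add_one, mul_comm r m]
      · intro c hc
        apply ih
        rw [mem_powersetCard] at hc
        have hac : a ∉ c := fun h => by simpa using hc.1 h
        rw [card_sdiff_of_subset (insert_subset ha (hc.1.trans (erase_subset _ _))),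
          card_insert_of_notMem hac, hc.2, hA, mul_add_one]
        omega

/-! ### The unique non-crossing partition -/

/-- Two finite sets of natural numbers cross unless one lies entirely to the left of the other. -/
def SetCrossing (s t : Finset ℕ) : Prop :=
  ¬ ((∀ i ∈ s, ∀ j ∈ t, i < j) ∨ (∀ j ∈ t, ∀ i ∈ s, j < i))

theorem SetCrossing.symm {s t : Finset ℕ} (h : SetCrossing s t) : SetCrossing t s :=
  fun h' => h h'.symm

theorem exists_initial_subset (S : Finset ℕ) {j : ℕ} (hj : j ≤ #S) :
    ∃ B ⊆ S, #B = j ∧ ∀ x ∈ B, ∀ y ∈ S \ B, x < y := by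
  induction j with
  | zero => exact ⟨∅, by simp⟩
  | succ j ih =>
    obtain ⟨B, hB, hcard, hlt⟩ := ih (by omega)
    have hne : (S \ B).Nonempty := by
      rw [← card_pos, card_sdiff_of_subset hB]
      omega
    have hm := mem_sdiff.1 ((S \ B).min'_mem hne)
    refine ⟨Insert.insert ((S \ B).min' hne) B, insert_subset hm.1 hB, ?_, ?_⟩
    · rw [card_insert_of_notMem hm.2, hcard]
    · intro x hx y hy
      simp only [mem_sdiff, mem_insert, not_or] at hy
      have hy' : y ∈ S \ B := mem_sdiff.2 ⟨hy.1, hy.2.2⟩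
      rcases mem_insert.1 hx with rfl | hx
      · exact lt_of_le_of_ne (min'_le _ _ hy') (Ne.symm hy.2.1)
      · exact hlt x hx y hy'

/-- Otherwise, the sizes being equal, there are `x ∈ B \ b` and `y ∈ b \ B`, and then both `x < y`
and `y < x`. -/
theorem eq_of_initial {S B b : Finset ℕ} (hB : B ⊆ S) (hb : b ⊆ S) (hcard : #B = #b)
    (h1 : ∀ x ∈ B, ∀ y ∈ S \ B, x < y) (h2 : ∀ x ∈ b, ∀ y ∈ S \ b, x < y) : B = b := by
  refine eq_of_subset_of_card_le (fun x hx => ?_) hcard.ge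
  by_contra hxb
  obtain ⟨y, hy, hyB⟩ : ∃ y ∈ b, y ∉ B := by
    by_contra! h
    exact hxb (eq_of_subset_of_card_le h hcard.le ▸ hx)
  exact lt_asymm (h1 x hx y (mem_sdiff.2 ⟨hb hy, hyB⟩)) (h2 y hy x (mem_sdiff.2 ⟨hB hx, hxb⟩))

/-- There is exactly one way to cut a set of `r * k` numbers into non-crossing blocks of
size `r`. -/
theorem existsUnique_independent_isUniformPartition {r k : ℕ} (hr : 1 ≤ r) {S : Finset ℕ}
    (hS : #S = r * k) :
    ∃! T, IsUniformPartition r S T ∧ Independent SetCrossing T := by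
  induction k generalizing S with
  | zero =>
    rw [mul_zero, card_eq_zero] at hS
    subst hS
    refine ⟨∅, ⟨by constructor <;> simp, fun x hx => by simp at hx⟩, ?_⟩
    rintro T ⟨hT, -⟩
    refine eq_empty_of_forall_notMem fun b hb => ?_
    obtain ⟨x, hx⟩ := hT.nonempty_block hr hb
    exact absurd (hT.subset b hb hx) (notMem_empty x)
  | succ k ih =>
    obtain ⟨B, hB, hcard, hlt⟩ := exists_initial_subset S (j := r) (by rw [hS]; nlinarith)
    obtain ⟨T₀, ⟨hT₀, hind₀⟩, huniq⟩ := ih (S := S \ B) (by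
      rw [card_sdiff_of_subset hB, hS, hcard, mul_add_one, Nat.add_sub_cancel])
    refine ⟨Insert.insert B T₀, ⟨.insert hB hcard hT₀, ?_⟩, ?_⟩
    · have key : ∀ c ∈ T₀, ¬ SetCrossing B c := fun c hc h =>
        h (Or.inl fun i hi j hj => hlt i hi j (hT₀.subset c hc hj))
      intro x hx y hy hxy
      rcases mem_insert.1 hx with hx' | hx' <;> rcases mem_insert.1 hy with hy' | hy'
      · rw [hx', hy']
      · exact absurd (hx' ▸ hxy) (key y hy')
      · exact absurd (hy' ▸ hxy).symm (key x hx')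
      · exact hind₀ x hx' y hy' hxy
    · rintro T ⟨hT, hind⟩
      have hne : S.Nonempty := card_pos.1 (by rw [hS]; positivity)
      obtain ⟨b, hb, hxb⟩ := hT.exists_mem _ (S.min'_mem hne)
      -- The block `b` of the minimum is an initial segment: any other block lies entirely to its
      -- left or right, and left is impossible.
      have hBb : B = b := by
        refine eq_of_initial hB (hT.subset b hb) (by rw [hcard, hT.card_block b hb]) hlt ?_
        intro y hy z hz
        rw [mem_sdiff] at hz
        obtain ⟨c, hc, hzc⟩ := hT.exists_mem z hz.1
        have hbc : ¬ SetCrossing b c := fun h => hz.2 (hind b hb c hc h ▸ hzc)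
        rcases not_not.1 hbc with h | h
        · exact h y hy z hzc
        · exact absurd (h z hzc _ hxb) (not_lt.2 (min'_le S z hz.1))
      subst hBb
      rw [← huniq (T.erase B) ⟨hT.erase hb, fun x hx y hy =>
        hind x (mem_of_mem_erase hx) y (mem_of_mem_erase hy)⟩, insert_erase hb]

/-! ### The recursion from the logarithm -/

/-- The logarithmic derivative of a power series. -/
theorem PowerSeries.mul_derivative_logOf {f : PowerSeries ℚ} (hf : constantCoeff f = 1) :
    f * derivative ℚ (logOf f) = derivative ℚ f := by
  have hs : HasSubst (f - 1) := HasSubst.of_constantCoeff_zero' (by simp [hf])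
  -- `log ℚ` is the series of `log (1 + X)`, so `f - 1` is what gets substituted for `X`.
  have h1 : (1 + X) * derivative ℚ (log ℚ) = 1 := by
    rw [deriv_log, add_mul, one_mul]
    ext n
    cases n with
    | zero => simp
    | succ n => simp [coeff_succ_X_mul, coeff_one, pow_succ]
  have h2 : f * (derivative ℚ (log ℚ)).subst (f - 1) = 1 := by
    have := congrArg (substAlgHom hs) h1
    rwa [map_mul, map_add, map_one, substAlgHom_X, coe_substAlgHom, add_sub_cancel] at this
  rw [logOf_eq, derivative_subst hs, ← mul_assoc, h2, one_mul, map_sub, derivative_one, sub_zero]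

/-- The recursion for the numbers `rNumber Q m` when `k! M(k) = (rk)! / r!^k`. -/
theorem sum_choose_mul_rNumber {r : ℕ} (hr : 1 ≤ r) (Q : ℕ → Type) [∀ n, PartialOrder (Q n)]
    (hQ : ∀ k, k.factorial * numMinimal Q k * r.factorial ^ k = (r * k).factorial)
    {m : ℕ} (hm : 1 ≤ m) :
    ∑ k ∈ range m, (-1 : ℚ) ^ k * (r * m - 1).choose (r * k) * rNumber Q (m - k) =
      (-1) ^ (m - 1) := by
  obtain ⟨m, rfl⟩ : ∃ m', m = m' + 1 := ⟨m - 1, by omega⟩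
  have hQ' : ∀ k, (k.factorial : ℚ) * numMinimal Q k =
      ((r * k).factorial : ℚ) / (r.factorial : ℚ) ^ k := by
    intro k
    rw [eq_div_iff (by positivity)]
    exact_mod_cast hQ k
  have hcoeff : ∀ k, PowerSeries.coeff k (signedSeries Q) =
      (-1) ^ k * (r.factorial : ℚ) ^ k / (r * k).factorial := by
    intro k
    rw [signedSeries, PowerSeries.coeff_mk, hQ', div_div_eq_mul_div]
  have hF : PowerSeries.constantCoeff (signedSeries Q) = 1 := by
    rw [← PowerSeries.coeff_zero_eq_constantCoeff_apply, hcoeff]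
    simp
  have hlog : ∀ k, PowerSeries.coeff k (PowerSeries.logOf (signedSeries Q)) =
      - (rNumber Q k * (r.factorial : ℚ) ^ k / (r * k).factorial) := by
    intro k
    rw [rNumber, hQ', map_neg]
    field_simp
  have h := congrArg (PowerSeries.coeff m) (PowerSeries.mul_derivative_logOf hF)
  rw [PowerSeries.coeff_mul, PowerSeries.coeff_derivative, hcoeff,
    Nat.sum_antidiagonal_eq_sum_range_succ_mk] at h
  have hpred : (((r * (m + 1)).factorial : ℕ) : ℚ) =
      r * (m + 1) * (r * (m + 1) - 1).factorial := by
    rw [← Nat.mul_factorial_pred (by positivity : r * (m + 1) ≠ 0)]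
    push_cast
    ring
  -- With `j = m - k`, the factor `j + 1` from the derivative turns `(r * (j + 1))!` into `r * (r *
  -- (j + 1) - 1)!` in the denominator up to cancellation, which produces the binomial coefficient
  -- with upper index `r * (m + 1) - 1`.
  have hterm : ∀ k ∈ range (m + 1),
      (-1 : ℚ) ^ k * (r * (m + 1) - 1).choose (r * k) * rNumber Q (m + 1 - k) =
      -((r * (m + 1) - 1).factorial * r / (r.factorial : ℚ) ^ (m + 1)) *
        (PowerSeries.coeff k (signedSeries Q) *
          PowerSeries.coeff (m - k) (PowerSeries.derivative ℚ
            (PowerSeries.logOf (signedSeries Q)))) := by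
    intro k hk
    rw [mem_range] at hk
    obtain ⟨j, rfl⟩ : ∃ j, m = k + j := ⟨m - k, by omega⟩
    have e1 : k + j + 1 - k = j + 1 := by omega
    have e2 : k + j - k = j := by omega
    have e3 : r * (k + j + 1) - 1 - r * k = r * (j + 1) - 1 := by
      rw [show r * (k + j + 1) = r * k + r * (j + 1) by ring]
      omega
    have hle : r * k ≤ r * (k + j + 1) - 1 := by
      have : r * 1 ≤ r * (j + 1) := Nat.mul_le_mul_left r (by omega)
      rw [show r * (k + j + 1) = r * k + r * (j + 1) by ring]
      omega
    have hfac : ((r * (j + 1)).factorial : ℚ) = r * (j + 1) * (r * (j + 1) - 1).factorial := by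
      rw [← Nat.mul_factorial_pred (by positivity : r * (j + 1) ≠ 0)]
      push_cast
      ring
    have hr0 : (r : ℚ) ≠ 0 := by positivity
    have hj0 : (j : ℚ) + 1 ≠ 0 := by positivity
    rw [e1, e2, PowerSeries.coeff_derivative, hcoeff, hlog, Nat.cast_choose ℚ hle, e3, hfac]
    field_simp
    ring
  rw [sum_congr rfl hterm, ← mul_sum, h, hpred, Nat.add_sub_cancel]
  have hr0 : (r : ℚ) ≠ 0 := by positivity
  have hm0 : (m : ℚ) + 1 ≠ 0 := by positivity
  field_simp
  ring

/-! ### The recursion for the number of pyramids -/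

open scoped Classical in
/-- The heap orders on `W` all of whose maximal elements contain `a`. -/
noncomputable def markedOrders (W : Finset (Finset ℕ)) (a : ℕ) :
    Finset (Finset (Finset ℕ × Finset ℕ)) :=
  {ρ ∈ heapOrders SetCrossing W | ∀ m ∈ maxElements W ρ, a ∈ m}

theorem mem_markedOrders {W : Finset (Finset ℕ)} {a : ℕ} {ρ : Finset (Finset ℕ × Finset ℕ)} :
    ρ ∈ markedOrders W a ↔ IsHeapOrder SetCrossing W ρ ∧ ∀ m ∈ maxElements W ρ, a ∈ m := by
  simp only [markedOrders, mem_filter, mem_heapOrders]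

/-- The number of pyramids whose elements are the blocks of a partition of `A` into blocks of
size `r`, with maximum the block containing `a`. -/
noncomputable def pyramidCount (r : ℕ) (A : Finset ℕ) (a : ℕ) : ℕ :=
  ∑ W ∈ uniformPartitions r A, #(markedOrders W a)

/-- Marking the maximum by a point `a` instead of a block `v` allows summation over all partitions
at once; for a single partition the two notions agree. -/
theorem markedOrders_eq_pyramidOrders {W : Finset (Finset ℕ)} {a : ℕ} {v : Finset ℕ}
    (hv : v ∈ W) (h : ∀ b ∈ W, a ∈ b ↔ b = v) :
    markedOrders W a = pyramidOrders SetCrossing W v := by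
  ext ρ
  simp only [mem_markedOrders, pyramidOrders, mem_filter, mem_heapOrders]
  refine and_congr_right fun hρ => ?_
  obtain ⟨m, hm, -⟩ := hρ.exists_le_maxElements hv
  have hsub : maxElements W ρ ⊆ W := fun b hb => (mem_maxElements.1 hb).1
  constructor
  · exact fun h' => eq_singleton_iff_nonempty_unique_mem.2
      ⟨⟨m, hm⟩, fun b hb => (h b (hsub hb)).1 (h' b hb)⟩
  · intro h' b hb
    exact (h b (hsub hb)).2 (mem_singleton.1 (h' ▸ hb))

theorem sum_pyramidCount_sdiff {r m : ℕ} (hr : 1 ≤ r) {A : Finset ℕ} {a : ℕ} (ha : a ∈ A)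
    (hA : #A = r * m) :
    ∑ S ∈ (A.erase a).powerset,
      (if r ∣ #S then (-1 : ℚ) ^ (#S / r) * pyramidCount r (A \ S) a else 0) =
      (-1) ^ (m - 1) := by
  classical
  -- The condition `v ∉ T` is expressed as `a ∉ T.biUnion id`, which makes sense without reference
  -- to `V`. Summing with `V` outside uses the inversion formula; summing with the union `S` of `T`
  -- outside uses uniqueness of the independent `T`.
  have key := sum_uniformPartitions_sum_powerset hr A (fun T W =>
    if a ∉ T.biUnion id ∧ Independent SetCrossing T then
      (-1 : ℚ) ^ #T * #(markedOrders W a) else 0)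
  have hleft : ∀ V ∈ uniformPartitions r A, (∑ T ∈ V.powerset,
      if a ∉ T.biUnion id ∧ Independent SetCrossing T then
        (-1 : ℚ) ^ #T * #(markedOrders (V \ T) a) else 0) =
      if Independent SetCrossing V then (-1) ^ (m - 1) else 0 := by
    intro V hV
    rw [mem_uniformPartitions] at hV
    obtain ⟨v, hv, hav⟩ := hV.exists_mem a ha
    have huniq : ∀ b ∈ V, a ∈ b ↔ b = v := fun b hb =>
      ⟨fun hab => hV.eq_of_mem b hb v hv a hab hav, fun hbv => hbv ▸ hav⟩
    have hcard : #V = m := Nat.eq_of_mul_eq_mul_left hr (hV.mul_card.trans hA)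
    rw [← hcard, ← sum_independent_card_pyramidOrders (fun _ _ h => h.symm) hv, ← sum_filter]
    have hiff : ∀ T ⊆ V, (a ∉ T.biUnion id ↔ v ∉ T) := by
      intro T hT
      simp only [mem_biUnion, id, not_exists, not_and]
      exact ⟨fun h hvT => h v hvT hav, fun h b hb hab => h ((huniq b (hT hb)).1 hab ▸ hb)⟩
    refine sum_congr (filter_congr fun T hT => ?_) fun T hT => ?_
    · rw [hiff T (mem_powerset.1 hT)]
    · rw [mem_filter, mem_powerset] at hT
      rw [markedOrders_eq_pyramidOrders (v := v) (mem_sdiff.2 ⟨hv, hT.2.1⟩)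
        fun b hb => huniq b (mem_sdiff.1 hb).1]
  have hright : ∀ S ∈ A.powerset, (∑ T ∈ uniformPartitions r S,
      ∑ W ∈ uniformPartitions r (A \ S), if a ∉ T.biUnion id ∧ Independent SetCrossing T then
        (-1 : ℚ) ^ #T * #(markedOrders W a) else 0) =
      if a ∉ S then
        if r ∣ #S then (-1 : ℚ) ^ (#S / r) * pyramidCount r (A \ S) a else 0
      else 0 := by
    intro S _
    have h1 : ∀ T ∈ uniformPartitions r S,
        (∑ W ∈ uniformPartitions r (A \ S), if a ∉ T.biUnion id ∧ Independent SetCrossing T then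
          (-1 : ℚ) ^ #T * #(markedOrders W a) else 0) =
        if Independent SetCrossing T then
          if a ∉ S then (-1 : ℚ) ^ (#S / r) * pyramidCount r (A \ S) a else 0 else 0 := by
      intro T hT
      rw [mem_uniformPartitions] at hT
      rw [hT.biUnion_eq, ← hT.mul_card, Nat.mul_div_cancel_left _ hr, pyramidCount]
      split_ifs <;> simp_all [mul_sum]
    rw [sum_congr rfl h1, ← sum_filter]
    by_cases hdvd : r ∣ #S
    · obtain ⟨k, hk⟩ := hdvd
      obtain ⟨T, hT, huniq⟩ := existsUnique_independent_isUniformPartition hr hk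
      have : (uniformPartitions r S).filter (Independent SetCrossing) = {T} := by
        ext T'
        rw [mem_filter, mem_uniformPartitions, mem_singleton]
        exact ⟨huniq T', fun h => h ▸ hT⟩
      simp only [this, sum_singleton, if_pos (Dvd.intro k hk.symm)]
    · rw [sum_eq_zero, if_neg hdvd, ite_self]
      intro T hT
      rw [mem_filter, mem_uniformPartitions] at hT
      exact absurd ⟨_, hT.1.mul_card.symm⟩ hdvd
  rw [sum_congr rfl hleft, sum_congr rfl hright, ← sum_filter, ← sum_filter] at key
  have hpow : A.powerset.filter (a ∉ ·) = (A.erase a).powerset := by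
    ext S
    simp [subset_erase]
  obtain ⟨V, hV, huniq⟩ := existsUnique_independent_isUniformPartition hr hA
  have hsing : (uniformPartitions r A).filter (Independent SetCrossing) = {V} := by
    ext T'
    rw [mem_filter, mem_uniformPartitions, mem_singleton]
    exact ⟨huniq T', fun h => h ▸ hV⟩
  rw [hpow, hsing, sum_singleton] at key
  exact key.symm

theorem sum_range_mul_ite_dvd {r : ℕ} (hr : 1 ≤ r) (m : ℕ) (f : ℕ → ℚ) (g : ℕ → ℚ) :
    ∑ j ∈ range (r * m), f j * (if r ∣ j then g (j / r) else 0) =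
      ∑ k ∈ range m, f (r * k) * g k := by
  simp only [mul_ite, mul_zero]
  rw [← sum_filter]
  refine (sum_nbij' (r * ·) (· / r) ?_ ?_ ?_ ?_ ?_).symm
  · intro k hk
    simp only [mem_filter, mem_range] at hk ⊢
    exact ⟨Nat.mul_lt_mul_of_pos_left hk hr, dvd_mul_right r k⟩
  · intro j hj
    simp only [mem_filter, mem_range] at hj ⊢
    exact Nat.div_lt_of_lt_mul hj.1
  · intro k _
    exact Nat.mul_div_cancel_left k hr
  · intro j hj
    exact Nat.mul_div_cancel' (mem_filter.1 hj).2
  · intro k _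
    simp only [Nat.mul_div_cancel_left k hr]

/-- The number of pyramids is determined by its recursion; in particular it only depends on the
number of elements of `A`. -/
theorem pyramidCount_eq {r : ℕ} (hr : 1 ≤ r) {c : ℕ → ℚ}
    (hc : ∀ m, 1 ≤ m → ∑ k ∈ range m, (-1 : ℚ) ^ k * (r * m - 1).choose (r * k) * c (m - k) =
      (-1) ^ (m - 1))
    {m : ℕ} {A : Finset ℕ} {a : ℕ} (ha : a ∈ A) (hA : #A = r * m) :
    (pyramidCount r A a : ℚ) = c m := by
  induction m using Nat.strong_induction_on generalizing A with
  | _ m ih =>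
  have hpos : 1 ≤ r * m := hA ▸ card_pos.2 ⟨a, ha⟩
  have hm : 1 ≤ m := Nat.pos_of_mul_pos_left hpos
  have h1 := sum_pyramidCount_sdiff hr ha hA
  have h2 : ∑ S ∈ (A.erase a).powerset,
      (if r ∣ #S then (-1 : ℚ) ^ (#S / r) * c (m - #S / r) else 0) = (-1) ^ (m - 1) := by
    -- The summand depends only on the size of `S`, and `A.erase a` has `r * m - 1` elements; hence
    -- the binomial coefficients.
    rw [sum_powerset_apply_card (fun j => if r ∣ j then (-1 : ℚ) ^ (j / r) * c (m - j / r) else 0),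
      card_erase_of_mem ha, hA, Nat.sub_add_cancel hpos, ← hc m hm]
    simp only [nsmul_eq_mul]
    rw [sum_range_mul_ite_dvd hr m (fun j => ((r * m - 1).choose j : ℚ))
      (fun k => (-1 : ℚ) ^ k * c (m - k))]
    exact sum_congr rfl fun k _ => by ring
  -- In the difference of the two recursions the terms with `S ≠ ∅` cancel by induction; `S = ∅`
  -- leaves the claim.
  rw [← h2, ← sub_eq_zero, ← sum_sub_distrib, sum_eq_single ∅] at h1
  · simpa [sub_eq_zero] using h1
  · intro S hS hne
    split_ifs with hdvd
    · obtain ⟨k, hk⟩ := hdvd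
      have hSA := mem_powerset.1 hS
      have hk0 : 0 < k := by
        refine Nat.pos_of_ne_zero ?_
        rintro rfl
        exact hne (card_eq_zero.1 hk)
      rw [hk, Nat.mul_div_cancel_left _ hr, ih (m - k) (by omega), sub_self]
      · exact mem_sdiff.2 ⟨ha, fun h => by simpa using hSA h⟩
      · rw [card_sdiff_of_subset (hSA.trans (erase_subset _ _)), hA, hk, Nat.mul_sub]
    · exact sub_self _
  · exact fun h => absurd (empty_mem_powerset _) h

/-! ### Minimal elements of the partition poset -/

theorem Finpartition.isUniformPartition {r : ℕ} {A : Finset ℕ} (π : Finpartition A)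
    (h : ∀ b ∈ π.parts, #b = r) : IsUniformPartition r A π.parts where
  subset _ hb := π.le hb
  card_block := h
  exists_mem _ hx := π.exists_mem hx
  eq_of_mem _ hb _ hc _ hxb hxc := π.eq_of_mem_parts hb hc hxb hxc

/-- A uniform partition as a `Finpartition`. -/
def IsUniformPartition.toFinpartition {r : ℕ} {A : Finset ℕ} {V : Finset (Finset ℕ)}
    (hr : 1 ≤ r) (h : IsUniformPartition r A V) : Finpartition A :=
  Finpartition.ofExistsUnique V h.subset
    (fun x hx => by
      obtain ⟨b, hb, hxb⟩ := h.exists_mem x hx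
      exact ⟨b, ⟨hb, hxb⟩, fun c hc => h.eq_of_mem c hc.1 b hb x hc.2 hxb⟩)
    (fun h0 => by simpa using h.nonempty_block hr h0)

/-- The minimal elements among the partitions into blocks of size divisible by `r` are the
partitions into blocks of size `r`. -/
theorem isMin_divPartition_iff {r k : ℕ} (hr : 1 ≤ r) (π : DivPartition r k) :
    IsMin π ↔ ∀ b ∈ π.1.parts, #b = r := by
  classical
  constructor
  · intro hmin
    -- Cutting every block into pieces of size `r` refines `π`, so by minimality it gives back `π`.
    have hex : ∀ b : Finset ℕ, b ∈ π.1.parts → ∃ σ : Finpartition b, ∀ c ∈ σ.parts, #c = r := by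
      intro b hb
      obtain ⟨j, hj⟩ := π.2 b hb
      obtain ⟨T, ⟨hT, -⟩, -⟩ := existsUnique_independent_isUniformPartition hr hj
      exact ⟨hT.toFinpartition hr, hT.card_block⟩
    choose σ hσ using hex
    have hcard : ∀ c ∈ (π.1.bind σ).parts, #c = r := by
      intro c hc
      obtain ⟨b, hb, hcb⟩ := Finpartition.mem_bind.1 hc
      exact hσ b hb c hcb
    have hle : (⟨π.1.bind σ, fun c hc => (hcard c hc).symm ▸ dvd_rfl⟩ : DivPartition r k) ≤ π := by
      intro c hc
      obtain ⟨b, hb, hcb⟩ := Finpartition.mem_bind.1 hc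
      exact ⟨b, hb, (σ b hb).le hcb⟩
    have heq := hle.antisymm (hmin hle)
    intro b hb
    rw [← heq] at hb
    exact hcard b hb
  · intro h τ hτ b hb
    obtain ⟨x, hx⟩ := π.1.nonempty_of_mem_parts hb
    obtain ⟨c, hc, hxc⟩ := τ.1.exists_mem (π.1.le hb hx)
    obtain ⟨b', hb', hcb⟩ := hτ hc
    have hbb : b = b' := π.1.eq_of_mem_parts hb hb' hx (hcb hxc)
    refine ⟨c, hc, ?_⟩
    have hle : r ≤ #c := Nat.le_of_dvd (card_pos.2 ⟨x, hxc⟩) (τ.2 c hc)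
    rw [hbb, eq_of_subset_of_card_le hcb (by rw [h b' hb']; exact hle)]

theorem factorial_mul_numMinimal {r : ℕ} (hr : 1 ≤ r) (k : ℕ) :
    k.factorial * numMinimal (fun k => DivPartition r k) k * r.factorial ^ k =
      (r * k).factorial := by
  rcases Nat.eq_zero_or_pos k with rfl | hk
  · simp [numMinimal]
  · have hcard : numMinimal (fun k => DivPartition r k) k = k.uniformBell r := by
      rw [numMinimal, if_neg hk.ne', ← card_uniformPartitions hr (A := Icc 1 (r * k)) (by simp),
        ← Nat.card_eq_finsetCard]
      let f : {x : DivPartition r k // IsMin x} → uniformPartitions r (Icc 1 (r * k)) := fun x =>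
        ⟨x.1.1.parts, mem_uniformPartitions.2
          (x.1.1.isUniformPartition ((isMin_divPartition_iff hr x.1).1 x.2))⟩
      refine Nat.card_eq_of_bijective f ⟨?_, ?_⟩
      · intro x y hxy
        exact Subtype.ext (Subtype.ext (Finpartition.ext (congrArg Subtype.val hxy)))
      · rintro ⟨V, hV⟩
        rw [mem_uniformPartitions] at hV
        exact ⟨⟨⟨hV.toFinpartition hr, fun b hb => (hV.card_block b hb).symm ▸ dvd_rfl⟩,
          (isMin_divPartition_iff hr _).2 hV.card_block⟩, rfl⟩
    rw [hcard, mul_comm r k, ← Nat.uniformBell_mul_eq k (by omega : r ≠ 0)]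
    ring

/-! ### From heap orders to isomorphism classes of heaps -/

/-- The elements of `V`, as a type that carries the heap order `ρ`. -/
def IsHeapOrder.Elements {α : Type} {C : α → α → Prop} {V : Finset α} {ρ : Finset (α × α)}
    (_ : IsHeapOrder C V ρ) : Type :=
  {b // b ∈ V}

instance IsHeapOrder.instPartialOrderElements {α : Type} {C : α → α → Prop} {V : Finset α}
    {ρ : Finset (α × α)} (h : IsHeapOrder C V ρ) : PartialOrder h.Elements where
  le x y := (x.1, y.1) ∈ ρ
  le_refl x := h.refl x.1 x.2
  le_trans x y z := h.trans x.1 y.1 z.1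
  le_antisymm x y h1 h2 := Subtype.ext (h.antisymm x.1 y.1 h1 h2)

theorem IsHeapOrder.rel_of_covBy {α : Type} {C : α → α → Prop} {V : Finset α}
    {ρ : Finset (α × α)} (h : IsHeapOrder C V ρ) {x y : h.Elements} (hxy : x ⋖ y) :
    C x.1 y.1 := by
  obtain ⟨z, h1, h2, h3, h4⟩ := h.step x.1 y.1 hxy.le fun h' => hxy.ne (Subtype.ext h')
  let z' : h.Elements := ⟨z, (h.mem _ _ h4).1⟩
  have hxz : x < z' := lt_of_le_of_ne h3 fun h' => h2 (congrArg Subtype.val h')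
  have hzy : z' ≤ y := h4
  have : z' = y := (eq_or_lt_of_le hzy).resolve_right (hxy.2 hxz)
  rw [← this]
  exact h1

/-- The heap defined by a heap order on the blocks of a uniform partition. -/
def IsHeapOrder.toHeap {r : ℕ} {A : Finset ℕ} {W : Finset (Finset ℕ)}
    {ρ : Finset (Finset ℕ × Finset ℕ)} (h : IsHeapOrder SetCrossing W ρ)
    (hW : IsUniformPartition r A W) (hA : ∀ i ∈ A, 1 ≤ i) : Heap (Crossing (r := r)) where
  carrier := h.Elements
  finite := inferInstanceAs (Finite {b // b ∈ W})
  label x := ⟨x.1, hW.card_block x.1 x.2, fun i hi => hA i (hW.subset x.1 x.2 hi)⟩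
  comparable x y hxy := h.comparable x.1 x.2 y.1 y.2 hxy
  covBy_rel _ _ hxy := h.rel_of_covBy hxy

namespace IsHeapOrder

variable {r : ℕ} {A : Finset ℕ} {W : Finset (Finset ℕ)} {ρ : Finset (Finset ℕ × Finset ℕ)}

theorem isMax_toHeap_iff (h : IsHeapOrder SetCrossing W ρ) (hW : IsUniformPartition r A W)
    (hA : ∀ i ∈ A, 1 ≤ i) (x : (h.toHeap hW hA).carrier) :
    IsMax x ↔ ((h.toHeap hW hA).label x).1 ∈ maxElements W ρ := by
  rw [mem_maxElements]
  constructor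
  · intro hx
    refine ⟨x.2, fun b hb => ?_⟩
    let y : (h.toHeap hW hA).carrier := ⟨b, (h.mem _ _ hb).2⟩
    exact h.antisymm _ _ (hx (b := y) hb) hb
  · rintro ⟨-, hx⟩ y hxy
    have : y = x := Subtype.ext (hx y.1 hxy)
    exact this.le

/-- Only one block contains `r * n`, so maximal elements all containing it coincide, and finiteness
provides one. -/
theorem mk_toHeap_mem_blockPyramids {n : ℕ} (hr : 1 ≤ r) (hn : 1 ≤ n)
    (h : IsHeapOrder SetCrossing W ρ) (hW : IsUniformPartition r (Icc 1 (r * n)) W)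
    (hA : ∀ i ∈ Icc 1 (r * n), 1 ≤ i) (hmax : ∀ m ∈ maxElements W ρ, r * n ∈ m) :
    (Quotient.mk _ (h.toHeap hW hA) : HeapClass (Crossing (r := r))) ∈ blockPyramids r n := by
  have hmem : r * n ∈ Icc 1 (r * n) := by
    rw [mem_Icc]
    exact ⟨Nat.mul_pos hr hn, le_rfl⟩
  refine ⟨_, rfl, ?_, ?_, ⟨⟨hW.toFinpartition hr, hW.card_block⟩, ?_, ?_⟩, ?_⟩
  · obtain ⟨v, hv, -⟩ := hW.exists_mem _ hmem
    obtain ⟨m, hm, -⟩ := h.exists_le_maxElements hv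
    let m' : (h.toHeap hW hA).carrier := ⟨m, (mem_maxElements.1 hm).1⟩
    refine ⟨m', (isMax_toHeap_iff h hW hA m').2 hm, fun y hy => ?_⟩
    have hy' := (isMax_toHeap_iff h hW hA y).1 hy
    exact Subtype.ext (hW.eq_of_mem _ y.2 _ m'.2 _ (hmax _ hy') (hmax _ hm))
  · have h1 : Nat.card (h.toHeap hW hA).carrier = #W := Nat.card_eq_finsetCard W
    rw [h1]
    refine Nat.eq_of_mul_eq_mul_left hr (hW.mul_card.trans ?_)
    simp
  · intro x y hxy
    have h1 : x.1 = y.1 := congrArg (fun b : Block r => b.1) hxy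
    exact Subtype.ext h1
  · intro b
    exact ⟨fun hb => ⟨⟨b, hb⟩, rfl⟩, fun ⟨x, hx⟩ => hx ▸ x.2⟩
  · intro m hm
    exact hmax _ ((isMax_toHeap_iff h hW hA m).1 hm)

/-- The elements are their own labels, so an isomorphism is the identity on blocks. Applied in both
directions, this makes heap orders faithful representatives of isomorphism classes. -/
theorem eq_of_iso_toHeap {W' : Finset (Finset ℕ)} {ρ' : Finset (Finset ℕ × Finset ℕ)}
    (h : IsHeapOrder SetCrossing W ρ) (hW : IsUniformPartition r A W) (hA : ∀ i ∈ A, 1 ≤ i)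
    (h' : IsHeapOrder SetCrossing W' ρ') (hW' : IsUniformPartition r A W')
    (hiso : Heap.Iso (h.toHeap hW hA) (h'.toHeap hW' hA)) : W ⊆ W' ∧ ρ ⊆ ρ' := by
  obtain ⟨e, he⟩ := hiso
  have key : ∀ x : (h.toHeap hW hA).carrier, ((e x).1 : Finset ℕ) = x.1 := fun x =>
    congrArg Subtype.val (he x)
  constructor
  · intro b hb
    have h1 : (e ⟨b, hb⟩).1 = b := key ⟨b, hb⟩
    exact h1 ▸ (e ⟨b, hb⟩).2
  · rintro ⟨b, c⟩ hbc
    have hm := h.mem b c hbc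
    let x : (h.toHeap hW hA).carrier := ⟨b, hm.1⟩
    let y : (h.toHeap hW hA).carrier := ⟨c, hm.2⟩
    have hxy : x ≤ y := hbc
    have h1 : ((e x).1, (e y).1) ∈ ρ' := e.monotone hxy
    rwa [key x, key y] at h1

end IsHeapOrder

/-- Every heap whose elements are the blocks of a partition comes from a heap order. -/
theorem Heap.exists_iso_toHeap {r n : ℕ} (H : Heap (Crossing (r := r)))
    (π : UniformPartition r n) (hH : HasBlocks H π) (hA : ∀ i ∈ Icc 1 (r * n), 1 ≤ i) :
    ∃ (ρ : Finset (Finset ℕ × Finset ℕ)) (h : IsHeapOrder SetCrossing π.1.parts ρ),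
      Heap.Iso (h.toHeap (π.1.isUniformPartition π.2) hA) H := by
  classical
  obtain ⟨hinj, hblocks⟩ := hH
  let ρ : Finset (Finset ℕ × Finset ℕ) := {p ∈ π.1.parts ×ˢ π.1.parts |
    ∃ x y : H.carrier, x ≤ y ∧ (H.label x).1 = p.1 ∧ (H.label y).1 = p.2}
  have hinj' : ∀ x y : H.carrier, (H.label x).1 = (H.label y).1 → x = y := fun x y hxy =>
    hinj (Subtype.ext hxy)
  have hpart : ∀ x : H.carrier, (H.label x).1 ∈ π.1.parts := fun x => (hblocks _).2 ⟨x, rfl⟩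
  have hρ : ∀ x y : H.carrier, ((H.label x).1, (H.label y).1) ∈ ρ ↔ x ≤ y := by
    intro x y
    simp only [ρ, mem_filter, mem_product, hpart, true_and]
    constructor
    · rintro ⟨x', y', hle, hx, hy⟩
      rwa [← hinj' _ _ hx, ← hinj' _ _ hy]
    · exact fun hle => ⟨x, y, hle, rfl, rfl⟩
  have hmem : ∀ b c, (b, c) ∈ ρ → b ∈ π.1.parts ∧ c ∈ π.1.parts := fun b c hbc =>
    mem_product.1 (mem_filter.1 hbc).1
  have hmem' : ∀ b c, (b, c) ∈ ρ → ∃ x y : H.carrier, (H.label x).1 = b ∧ (H.label y).1 = c := by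
    intro b c hbc
    obtain ⟨x, hx⟩ := (hblocks b).1 (hmem b c hbc).1
    obtain ⟨y, hy⟩ := (hblocks c).1 (hmem b c hbc).2
    exact ⟨x, y, hx, hy⟩
  have hheap : IsHeapOrder SetCrossing π.1.parts ρ := by
    refine ⟨hmem, ?_, ?_, ?_, ?_, ?_⟩
    · intro b hb
      obtain ⟨x, rfl⟩ := (hblocks b).1 hb
      exact (hρ x x).2 le_rfl
    · intro b c d hbc hcd
      obtain ⟨x, y, rfl, rfl⟩ := hmem' b c hbc
      obtain ⟨z, rfl⟩ := (hblocks d).1 (hmem _ _ hcd).2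
      exact (hρ x z).2 (((hρ x y).1 hbc).trans ((hρ y z).1 hcd))
    · intro b c hbc hcb
      obtain ⟨x, y, rfl, rfl⟩ := hmem' b c hbc
      rw [((hρ x y).1 hbc).antisymm ((hρ y x).1 hcb)]
    · intro b hb c hc hbc
      obtain ⟨x, rfl⟩ := (hblocks b).1 hb
      obtain ⟨y, rfl⟩ := (hblocks c).1 hc
      rw [hρ, hρ]
      exact H.comparable x y hbc
    · intro b c hbc hne
      obtain ⟨x, y, rfl, rfl⟩ := hmem' b c hbc
      have hxy : x < y := lt_of_le_of_ne ((hρ x y).1 hbc) fun h => hne (h ▸ rfl)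
      -- By finiteness some cover of `x` lies below `y`, and its label is related to that of `x`.
      obtain ⟨z, hz, hzy⟩ := exists_covBy_le_of_lt hxy
      exact ⟨_, H.covBy_rel x z hz, fun h => hz.ne (hinj' _ _ h), (hρ x z).2 hz.le,
        (hρ z y).2 hzy⟩
  refine ⟨ρ, hheap, ?_⟩
  apply (Heap.isoSetoid (Crossing (r := r))).symm'
  let f : H.carrier → (hheap.toHeap (π.1.isUniformPartition π.2) hA).carrier :=
    fun x => ⟨(H.label x).1, hpart x⟩
  have hf : Function.Bijective f := by
    refine ⟨fun x y hxy => hinj' x y ?_, fun b => ?_⟩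
    · exact congrArg (fun b : {b // b ∈ π.1.parts} => b.1) hxy
    obtain ⟨x, hx⟩ := (hblocks b.1).1 b.2
    exact ⟨x, Subtype.ext hx⟩
  exact ⟨⟨Equiv.ofBijective f hf, fun {x y} => hρ x y⟩, fun x => rfl⟩

theorem Heap.Iso.isMax_label {B : Type*} {R : B → B → Prop} {H K : Heap R} (h : Heap.Iso H K)
    {p : B → Prop} (hK : ∀ m : K.carrier, IsMax m → p (K.label m)) (m : H.carrier)
    (hm : IsMax m) : p (H.label m) := by
  obtain ⟨e, he⟩ := h
  rw [← he]
  exact hK _ (e.isMax_apply.2 hm)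

/-- The block pyramids are counted by `pyramidCount`. -/
theorem finite_blockPyramids_and_ncard {r n : ℕ} (hr : 1 ≤ r) (hn : 1 ≤ n) :
    (blockPyramids r n).Finite ∧
      (blockPyramids r n).ncard = pyramidCount r (Icc 1 (r * n)) (r * n) := by
  have hA : ∀ i ∈ Icc 1 (r * n), 1 ≤ i := fun i hi => (mem_Icc.1 hi).1
  let D : Finset (Σ _ : Finset (Finset ℕ), Finset (Finset ℕ × Finset ℕ)) :=
    (uniformPartitions r (Icc 1 (r * n))).sigma fun W => markedOrders W (r * n)
  have hD : ∀ p ∈ D, IsUniformPartition r (Icc 1 (r * n)) p.1 ∧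
      IsHeapOrder SetCrossing p.1 p.2 ∧ ∀ m ∈ maxElements p.1 p.2, r * n ∈ m := by
    intro p hp
    rwa [mem_sigma, mem_uniformPartitions, mem_markedOrders] at hp
  let f : D → HeapClass (Crossing (r := r)) := fun p =>
    Quotient.mk _ ((hD p.1 p.2).2.1.toHeap (hD p.1 p.2).1 hA)
  have hf : Function.Injective f := by
    intro p q hpq
    have h1 := IsHeapOrder.eq_of_iso_toHeap _ _ _ _ _ (Quotient.exact hpq)
    have h2 := IsHeapOrder.eq_of_iso_toHeap _ _ _ _ _ (Quotient.exact hpq.symm)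
    exact Subtype.ext (Sigma.ext (h1.1.antisymm h2.1) (heq_of_eq (h1.2.antisymm h2.2)))
  have hrange : blockPyramids r n = Set.range f := by
    refine Set.Subset.antisymm ?_ ?_
    · rintro _ ⟨H, rfl, -, -, ⟨π, hπ⟩, hmax⟩
      obtain ⟨ρ, h, hiso⟩ := H.exists_iso_toHeap π hπ hA
      have hW := π.1.isUniformPartition π.2
      have hm : ∀ m ∈ maxElements π.1.parts ρ, r * n ∈ m := by
        intro m hm
        let x : (h.toHeap hW hA).carrier := ⟨m, (mem_maxElements.1 hm).1⟩
        exact hiso.isMax_label (p := fun b => r * n ∈ b.1) hmax x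
          ((h.isMax_toHeap_iff hW hA x).2 hm)
      have hp : (⟨π.1.parts, ρ⟩ : Σ _ : Finset (Finset ℕ), Finset (Finset ℕ × Finset ℕ)) ∈ D := by
        rw [mem_sigma, mem_uniformPartitions, mem_markedOrders]
        exact ⟨hW, h, hm⟩
      exact ⟨⟨_, hp⟩, Quotient.sound hiso⟩
    · rintro _ ⟨p, rfl⟩
      obtain ⟨hW, h, hmax⟩ := hD p.1 p.2
      exact h.mk_toHeap_mem_blockPyramids hr hn hW hA hmax
  rw [hrange]
  refine ⟨Set.finite_range f, ?_⟩
  rw [← Nat.card_coe_set_eq, Nat.card_range_of_injective hf, Nat.card_eq_finsetCard, card_sigma,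
    pyramidCount]

theorem mainTheorem3 (r n : ℕ) (hr : 1 ≤ r) (hn : 1 ≤ n) :
    (blockPyramids r n).Finite ∧
      rNumber (fun k => DivPartition r k) n = ((blockPyramids r n).ncard : ℚ) := by
  obtain ⟨hfin, hcard⟩ := finite_blockPyramids_and_ncard hr hn
  refine ⟨hfin, ?_⟩
  have hmem : r * n ∈ Icc 1 (r * n) := by
    rw [mem_Icc]
    exact ⟨Nat.mul_pos hr hn, le_rfl⟩
  rw [hcard, pyramidCount_eq hr (m := n)
    (fun m hm => sum_choose_mul_rNumber hr _ (factorial_mul_numMinimal hr) hm) hmem (by simp)]
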